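/- Let $A$ and $B$ be (not necessarily unital) complex $C^*$-algebras and let $\varepsilon\ge 0$. For a $C^*$-algebra $D$, call a bounded linear map $\psi\colon D\to E$ into a $C^*$-algebra $E$ \emph{$\varepsilon$-order zero} if $\|\psi(x)\psi(y)\|\le\varepsilon\|x\|\,\|y\|$ for all positive $x,y\in D$ with $x\perp y$, where $x\perp y$ means $xy=yx=x^*y=xy^*=0$. Let $\varphi\colon A\to B$ be a bounded linear $\varepsilon$-order zero map and let $\varphi^{**}\colon A^{**}\to B^{**}$ be its second adjoint, where $B^{**}$ carries its norm as a bidual space and the Arens product, $(xy)(\xi)=x\bigl(b\mapsto y(c\mapsto\xi(bc))\bigr)$ for $x,y\in B^{**}$, $\xi\in B^*$ (this is the usual $C^*$-algebra structure of $B^{**}$). Let $A_0\subseteq A$ be a commutative separable $C^*$-subalgebra with spectrum (character space) $\sigma(A_0)$, and let $B(\sigma(A_0))$ be the $C^*$-algebra of bounded complex-valued Borel functions on $\sigma(A_0)$ with the supremum norm, regarded as a subalgebra of $A^{**}$ via $f\mapsto\bigl(\psi\mapsto\int_{\sigma(A_0)}f\,d\mu_\psi\bigr)$, where, for $\psi\in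 A^*$, $\mu_\psi$ is the unique complex Borel measure on $\sigma(A_0)$ with $\psi(a)=\int_{\sigma(A_0)}\chi(a)\,d\mu_\psi(\chi)$ for all $a\in A_0$. Then the restriction $\varphi^{**}\!\restriction_{B(\sigma(A_0))}\colon B(\sigma(A_0))\to B^{**}$ is $\varepsilon$-order zero. -/

import Mathlib

noncomputable section

open MeasureTheory WeakDual ComplexConjugate
open scoped ENNReal

/-! ### Riesz representation on a compact space -/

theorem exists_measure_of_pos {K : Type*} [TopologicalSpace K] [CompactSpace K] [T2Space K]
    [MeasurableSpace K] [BorelSpace K] (P : C(K, ℝ) →ₗ[ℝ] ℝ) (hP : ∀ h, 0 ≤ h → 0 ≤ P h) :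
    ∃ μ : Measure K, IsFiniteMeasure μ ∧ ∀ h : C(K, ℝ), P h = ∫ x, h x ∂μ := by
  let Λ : CompactlySupportedContinuousMap K ℝ →ₚ[ℝ] ℝ :=
  { toFun g := P g.toContinuousMap
    map_add' g g' := P.map_add _ _
    map_smul' c g := P.map_smul _ _
    monotone' g g' hgg' := by
      have := hP (g'.toContinuousMap - g.toContinuousMap) (fun x => sub_nonneg.2 (hgg' x))
      rw [map_sub] at this
      exact sub_nonneg.1 this }
  refine ⟨RealRMK.rieszMeasure Λ, inferInstance, fun h => ?_⟩
  exact (RealRMK.integral_rieszMeasure Λ ⟨h, HasCompactSupport.of_compactSpace _⟩).symm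

theorem exists_measures_of_bounded {K : Type*} [TopologicalSpace K] [CompactSpace K] [T2Space K]
    [MeasurableSpace K] [BorelSpace K] (L : C(K, ℝ) →ₗ[ℝ] ℝ) (M : ℝ) (hM : 0 ≤ M)
    (hL : ∀ h, L h ≤ M * ‖h‖) :
    ∃ μ ν : Measure K, IsFiniteMeasure μ ∧ IsFiniteMeasure ν ∧ μ.real Set.univ ≤ M ∧
      ν.real Set.univ ≤ M ∧ ∀ h : C(K, ℝ), L h = ∫ x, h x ∂μ - ∫ x, h x ∂ν := by
  let N : C(K, ℝ) × C(K, ℝ) → ℝ := fun p => M * max ‖p.1 ⊔ 0‖ ‖p.2 ⊔ 0‖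
  have norm_le (h : C(K, ℝ)) (c : ℝ) (hc : 0 ≤ c) (hh : ∀ x, h x ≤ c) : ‖h ⊔ 0‖ ≤ c := by
    refine (ContinuousMap.norm_le _ hc).2 fun x => ?_
    rw [Real.norm_eq_abs, abs_of_nonneg (by simp)]
    simp [hh x, hc]
  have le_norm (h : C(K, ℝ)) (x : K) : h x ≤ ‖h ⊔ 0‖ :=
    (le_max_left (h x) 0).trans ((le_abs_self _).trans ((h ⊔ 0).norm_coe_le_norm x))
  let D : Submodule ℝ (C(K, ℝ) × C(K, ℝ)) :=
    LinearMap.ker (LinearMap.fst ℝ C(K, ℝ) C(K, ℝ) + LinearMap.snd ℝ C(K, ℝ) C(K, ℝ))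
  let f : (C(K, ℝ) × C(K, ℝ)) →ₗ.[ℝ] ℝ :=
    ⟨D, L ∘ₗ (LinearMap.fst ℝ C(K, ℝ) C(K, ℝ)) ∘ₗ D.subtype⟩
  obtain ⟨g, hg, hgN⟩ := exists_extension_of_le_sublinear f N
    (by
      intro c hc p
      have key (h : C(K, ℝ)) : ‖(c • h) ⊔ 0‖ = c * ‖h ⊔ 0‖ := by
        have : (c • h) ⊔ 0 = c • (h ⊔ 0) := by
          ext x
          simp [mul_max_of_nonneg _ _ hc.le]
        rw [this, norm_smul, Real.norm_eq_abs, abs_of_pos hc]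
      simp only [N, Prod.smul_fst, Prod.smul_snd, key]
      rw [← mul_max_of_nonneg _ _ hc.le]
      ring)
    (by
      intro p q
      simp only [N, Prod.fst_add, Prod.snd_add]
      rw [← mul_add]
      refine mul_le_mul_of_nonneg_left (max_le ?_ ?_) hM
      · refine norm_le _ _ (by positivity) fun x => ?_
        exact add_le_add ((le_norm _ x).trans (le_max_left _ _))
          ((le_norm _ x).trans (le_max_left _ _))
      · refine norm_le _ _ (by positivity) fun x => ?_
        exact add_le_add ((le_norm _ x).trans (le_max_right _ _))
          ((le_norm _ x).trans (le_max_right _ _)))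
    (by
      rintro ⟨⟨u, v⟩, huv⟩
      have huv' : u + v = 0 := huv
      obtain rfl : v = -u := (neg_eq_of_add_eq_zero_right huv').symm
      refine (hL u).trans (mul_le_mul_of_nonneg_left ?_ hM)
      refine (ContinuousMap.norm_le _ (by positivity)).2 fun x => ?_
      rw [Real.norm_eq_abs]
      refine abs_le'.2 ⟨(le_norm _ x).trans (le_max_left _ _), ?_⟩
      exact (le_norm (-u) x).trans (le_max_right _ _))
  have hpos (p : C(K, ℝ) × C(K, ℝ)) (h1 : 0 ≤ p.1) (h2 : 0 ≤ p.2) : 0 ≤ g p := by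
    have := hgN (-p)
    have e1 : (-p).1 ⊔ 0 = 0 := sup_eq_right.2 (by simpa using h1)
    have e2 : (-p).2 ⊔ 0 = 0 := sup_eq_right.2 (by simpa using h2)
    simp only [N, e1, e2, map_neg, norm_zero, max_self, mul_zero] at this
    linarith
  obtain ⟨μ, hμ, hμ'⟩ := exists_measure_of_pos (g ∘ₗ LinearMap.inl ℝ C(K, ℝ) C(K, ℝ))
    (fun h hh => hpos _ hh le_rfl)
  obtain ⟨ν, hν, hν'⟩ := exists_measure_of_pos (g ∘ₗ LinearMap.inr ℝ C(K, ℝ) C(K, ℝ))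
    (fun h hh => hpos _ le_rfl hh)
  have one_le : ‖(1 : C(K, ℝ)) ⊔ 0‖ ≤ 1 := norm_le _ _ zero_le_one fun x => le_rfl
  refine ⟨μ, ν, hμ, hν, ?_, ?_, fun h => ?_⟩
  · have h1 := hμ' 1
    have h2 := hgN (1, 0)
    simp only [LinearMap.comp_apply, LinearMap.inl_apply, ContinuousMap.one_apply,
      integral_const, smul_eq_mul, mul_one] at h1
    rw [← h1]
    refine h2.trans ?_
    simp only [N]
    calc _ ≤ M * 1 := by gcongr; simpa using one_le
      _ = M := mul_one M
  · have h1 := hν' 1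
    have h2 := hgN (0, 1)
    simp only [LinearMap.comp_apply, LinearMap.inr_apply, ContinuousMap.one_apply,
      integral_const, smul_eq_mul, mul_one] at h1
    rw [← h1]
    refine h2.trans ?_
    simp only [N]
    calc _ ≤ M * 1 := by gcongr; simpa using one_le
      _ = M := mul_one M
  · have h0 := hg ⟨(h, -h), by simp [f, D]⟩
    have h1 : g (h, -h) = L h := h0
    rw [← hμ', ← hν', ← h1]
    simp only [LinearMap.comp_apply, ← map_sub]
    simp

/-! ### The spectrum of a commutative C⋆-algebra -/

instance characterSpace.instMeasurableSpace {C : Type*} [NonUnitalCommCStarAlgebra C] :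
    MeasurableSpace (characterSpace ℂ C) := borel _

instance characterSpace.instBorelSpace {C : Type*} [NonUnitalCommCStarAlgebra C] :
    BorelSpace (characterSpace ℂ C) := ⟨rfl⟩

/-- The extension of a character to the unitization. -/
def charExt {C : Type*} [NonUnitalCommCStarAlgebra C] (χ : characterSpace ℂ C) :
    characterSpace ℂ (Unitization ℂ C) :=
  CharacterSpace.equivAlgHom.symm (Unitization.lift (CharacterSpace.toNonUnitalAlgHom χ))

section

variable {C : Type*} [NonUnitalCommCStarAlgebra C]

theorem char_apply (κ : characterSpace ℂ (Unitization ℂ C)) (z : Unitization ℂ C) :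
    κ z = z.fst + κ (z.snd : Unitization ℂ C) := by
  conv_lhs => rw [← Unitization.inl_fst_add_inr_snd_eq z]
  rw [map_add]
  congr 1
  have := AlgHomClass.commutes κ z.fst
  simpa [Unitization.algebraMap_eq_inl] using this

theorem charExt_inr (χ : characterSpace ℂ C) (a : C) :
    charExt χ (a : Unitization ℂ C) = χ a := by
  simp [charExt]

/-- The restriction of a character of the unitization. -/
def charRes (κ : characterSpace ℂ (Unitization ℂ C)) : WeakDual ℂ C :=
  StrongDual.toWeakDual ((CharacterSpace.toCLM κ).comp
    (⟨Unitization.inrHom ℂ ℂ C, Unitization.continuous_inr⟩ :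
      C →L[ℂ] Unitization ℂ C))

theorem charRes_apply (κ : characterSpace ℂ (Unitization ℂ C)) (a : C) :
    charRes κ a = κ (a : Unitization ℂ C) := rfl

theorem continuous_charRes :
    Continuous (charRes : characterSpace ℂ (Unitization ℂ C) → WeakDual ℂ C) :=
  continuous_of_continuous_eval fun a =>
    (WeakDual.eval_continuous (a : Unitization ℂ C)).comp continuous_subtype_val

theorem charRes_charExt (χ : characterSpace ℂ C) : charRes (charExt χ) = (χ : WeakDual ℂ C) :=
  DFunLike.ext _ _ fun a => charExt_inr χ a

theorem continuous_charExt :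
    Continuous (charExt : characterSpace ℂ C → characterSpace ℂ (Unitization ℂ C)) := by
  refine Continuous.subtype_mk (continuous_of_continuous_eval fun z => ?_) _
  have : (fun χ : characterSpace ℂ C => charExt χ z) = fun χ =>
      z.fst + χ z.snd := by
    funext χ
    rw [char_apply, charExt_inr]
  exact (continuous_const.add ((WeakDual.eval_continuous z.snd).comp continuous_subtype_val)).congr
    fun χ => (congrFun this χ).symm

theorem mem_range_charExt {κ : characterSpace ℂ (Unitization ℂ C)} (h : charRes κ ≠ 0) :
    κ ∈ Set.range (charExt : characterSpace ℂ C → _) := by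
  refine ⟨⟨charRes κ, h, fun a b => ?_⟩, ?_⟩
  · simp [charRes_apply]
  · refine CharacterSpace.ext fun z => ?_
    rw [char_apply, char_apply κ, charExt_inr]; rfl

theorem range_charExt :
    Set.range (charExt : characterSpace ℂ C → characterSpace ℂ (Unitization ℂ C)) =
      charRes ⁻¹' {0}ᶜ := by
  ext κ
  refine ⟨?_, mem_range_charExt⟩
  rintro ⟨χ, rfl⟩
  simpa [charRes_charExt] using χ.2.1

theorem measurableEmbedding_charExt :
    MeasurableEmbedding (charExt : characterSpace ℂ C → characterSpace ℂ (Unitization ℂ C)) := by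
  have h1 : Topology.IsEmbedding
      (charRes ∘ (charExt : characterSpace ℂ C → characterSpace ℂ (Unitization ℂ C))) := by
    have : charRes ∘ (charExt : characterSpace ℂ C → characterSpace ℂ (Unitization ℂ C)) =
      Subtype.val := funext charRes_charExt
    rw [this]; exact Topology.IsEmbedding.subtypeVal
  refine (Topology.IsEmbedding.of_comp continuous_charExt continuous_charRes h1).measurableEmbedding
    ?_
  rw [range_charExt]
  exact (isOpen_compl_singleton.preimage continuous_charRes).measurableSet

/-- The character of the unitization which vanishes on `C`. -/
def charInfty (C : Type*) [NonUnitalCommCStarAlgebra C] : characterSpace ℂ (Unitization ℂ C) :=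
  CharacterSpace.equivAlgHom.symm (Unitization.fstHom ℂ C)

theorem charInfty_apply (z : Unitization ℂ C) : charInfty C z = z.fst := rfl

theorem charInfty_notMem : charInfty C ∉ Set.range (charExt : characterSpace ℂ C → _) := by
  rw [range_charExt]
  simp only [Set.mem_preimage, Set.mem_compl_iff, Set.mem_singleton_iff, not_not]
  exact DFunLike.ext _ _ fun a => by
    rw [charRes_apply, charInfty_apply]; simp; rfl

theorem continuous_char_apply (a : C) : Continuous fun χ : characterSpace ℂ C => χ a :=
  (WeakDual.eval_continuous a).comp continuous_subtype_val

theorem norm_char_apply_le (χ : characterSpace ℂ C) (a : C) : ‖χ a‖ ≤ ‖a‖ := by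
  rw [← charExt_inr, ← Unitization.norm_inr (𝕜 := ℂ) a]
  exact spectrum.norm_le_norm_of_mem (CharacterSpace.apply_mem_spectrum _ _)

theorem char_star (χ : characterSpace ℂ C) (a : C) : χ (star a) = conj (χ a) := by
  rw [← charExt_inr χ, ← charExt_inr χ, Unitization.inr_star, map_star]
  rfl

theorem integrable_char (a : C) (μ : Measure (characterSpace ℂ C)) [IsFiniteMeasure μ] :
    Integrable (fun χ : characterSpace ℂ C => χ a) μ :=
  Integrable.of_bound (continuous_char_apply a).aestronglyMeasurable ‖a‖
    (ae_of_all _ fun χ => norm_char_apply_le χ a)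

/-- Finite Borel measures on the spectrum are determined by the integrals of Gelfand transforms. -/
theorem measure_ext_of_char [TopologicalSpace.SeparableSpace C]
    (μ ν : Measure (characterSpace ℂ C)) [IsFiniteMeasure μ] [IsFiniteMeasure ν]
    (h : ∀ a : C, ∫ χ, χ a ∂μ = ∫ χ, χ a ∂ν) : μ = ν := by
  have : TopologicalSpace.SeparableSpace (Unitization ℂ C) := by
    have hd : DenseRange (fun p : ℂ × C => (Unitization.inl p.1 + (p.2 : Unitization ℂ C))) :=
      Function.Surjective.denseRange fun z => ⟨(z.fst, z.snd), Unitization.inl_fst_add_inr_snd_eq z⟩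
    refine hd.separableSpace ?_
    have h1 : Continuous (fun c : ℂ => (Unitization.inl c : Unitization ℂ C)) := by
      simpa [← Unitization.algebraMap_eq_inl] using continuous_algebraMap ℂ (Unitization ℂ C)
    exact (h1.comp continuous_fst).add (Unitization.continuous_inr.comp continuous_snd)
  have : TopologicalSpace.MetrizableSpace (characterSpace ℂ (Unitization ℂ C)) :=
    WeakDual.metrizable_of_isCompact ℂ _ _ (isCompact_iff_compactSpace.2 inferInstance)
  let _ : MetricSpace (characterSpace ℂ (Unitization ℂ C)) := TopologicalSpace.metrizableSpaceMetric _
  have hj := measurableEmbedding_charExt (C := C)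
  let μ' := μ.map charExt + ν Set.univ • Measure.dirac (charInfty C)
  let ν' := ν.map charExt + μ Set.univ • Measure.dirac (charInfty C)
  have : IsFiniteMeasure (ν Set.univ • Measure.dirac (charInfty C)) :=
    Measure.smul_finite _ (measure_ne_top _ _)
  have : IsFiniteMeasure (μ Set.univ • Measure.dirac (charInfty C)) :=
    Measure.smul_finite _ (measure_ne_top _ _)
  have key (ρ ρ' : Measure (characterSpace ℂ C)) [IsFiniteMeasure ρ] [IsFiniteMeasure ρ']
      (z : Unitization ℂ C) :
      ∫ κ, κ z ∂(ρ.map charExt + ρ' Set.univ • Measure.dirac (charInfty C)) =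
        (ρ.real Set.univ + ρ'.real Set.univ : ℝ) * z.fst + ∫ χ, χ z.snd ∂ρ := by
    have : IsFiniteMeasure (ρ' Set.univ • Measure.dirac (charInfty C)) :=
      Measure.smul_finite _ (measure_ne_top _ _)
    have hi (m : Measure (characterSpace ℂ (Unitization ℂ C))) [IsFiniteMeasure m] :
        Integrable (fun κ : characterSpace ℂ (Unitization ℂ C) => κ z) m :=
      (gelfandTransform ℂ (Unitization ℂ C) z).continuous.integrable_of_hasCompactSupport
        (HasCompactSupport.of_compactSpace _)
    rw [integral_add_measure (hi _) (hi _), hj.integral_map, integral_smul_measure,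
      integral_dirac, charInfty_apply]
    have : ∀ χ : characterSpace ℂ C, charExt χ z = z.fst + χ z.snd := fun χ => by
      rw [char_apply, charExt_inr]
    simp only [this]
    rw [integral_add (integrable_const _) (integrable_char _ _), integral_const]
    simp only [Measure.real, Complex.real_smul]
    push_cast
    ring
  have e : μ' = ν' := by
    refine ext_of_forall_integral_eq_of_IsFiniteMeasure fun f => ?_
    obtain ⟨z, hz⟩ := (gelfandTransform_bijective (Unitization ℂ C)).2
      ⟨fun κ => (f κ : ℂ), by fun_prop⟩
    have hz' (κ : characterSpace ℂ (Unitization ℂ C)) : ((f κ : ℝ) : ℂ) = κ z :=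
      (DFunLike.congr_fun hz κ).symm
    have : (∫ κ, ((f κ : ℝ) : ℂ) ∂μ') = ∫ κ, ((f κ : ℝ) : ℂ) ∂ν' := by
      simp only [hz', μ', ν', key, h]
      rw [add_comm (μ.real _)]
    rw [integral_complex_ofReal, integral_complex_ofReal] at this
    exact_mod_cast this
  have hc (ρ : Measure (characterSpace ℂ C)) (c : ℝ≥0∞) :
      (ρ.map charExt + c • Measure.dirac (charInfty C)).comap charExt = ρ := by
    ext s hs
    rw [hj.comap_apply]
    have : MeasurableSet (charExt '' s) := hj.measurableSet_image.2 hs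
    simp only [Measure.add_apply, Measure.smul_apply, smul_eq_mul, hj.map_apply,
      hj.injective.preimage_image]
    rw [Measure.dirac_apply' _ this, Set.indicator_of_notMem]
    · simp
    · exact fun hm => charInfty_notMem (Set.image_subset_range _ _ hm)
  calc μ = μ'.comap charExt := (hc μ _).symm
    _ = ν'.comap charExt := congrArg _ e
    _ = ν := hc ν _
end

section

variable {C : Type*} [NonUnitalCommCStarAlgebra C]

theorem real_sum_integral_eq_zero [TopologicalSpace.SeparableSpace C] {ι : Type*} [Fintype ι]
    (r : ι → ℝ) (μ : ι → FiniteMeasure (characterSpace ℂ C))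
    (h : ∀ a : C, ∑ i, (r i : ℂ) * ∫ χ, χ a ∂(μ i : Measure (characterSpace ℂ C)) = 0)
    (f : characterSpace ℂ C → ℂ) (hf : Measurable f) (M : ℝ) (hM : ∀ χ, ‖f χ‖ ≤ M) :
    ∑ i, (r i : ℂ) * ∫ χ, f χ ∂(μ i : Measure (characterSpace ℂ C)) = 0 := by
  let m (s : ι → ℝ) : Measure (characterSpace ℂ C) :=
    ∑ i, (Real.toNNReal (s i)) • (μ i : Measure (characterSpace ℂ C))
  have hm (s : ι → ℝ) : IsFiniteMeasure (m s) := by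
    refine ⟨?_⟩
    simp only [m, Measure.finsetSum_apply]
    exact ENNReal.sum_lt_top.2 fun i _ => measure_lt_top _ _
  have hint (s : ι → ℝ) (g : characterSpace ℂ C → ℂ)
      (hg : ∀ i, Integrable g (μ i : Measure (characterSpace ℂ C))) :
      ∫ χ, g χ ∂(m s) = ∑ i, ((max (s i) 0 : ℝ) : ℂ) *
        ∫ χ, g χ ∂(μ i : Measure (characterSpace ℂ C)) := by
    rw [integral_finsetSum_measure fun i _ => (hg i).smul_measure_nnreal]
    refine Finset.sum_congr rfl fun i _ => ?_
    rw [integral_smul_nnreal_measure, NNReal.smul_def, Complex.real_smul, Real.coe_toNNReal']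
  have hdiff (g : characterSpace ℂ C → ℂ)
      (hg : ∀ i, Integrable g (μ i : Measure (characterSpace ℂ C))) :
      ∫ χ, g χ ∂(m r) - ∫ χ, g χ ∂(m (-r)) =
        ∑ i, (r i : ℂ) * ∫ χ, g χ ∂(μ i : Measure (characterSpace ℂ C)) := by
    rw [hint _ _ hg, hint _ _ hg, ← Finset.sum_sub_distrib]
    refine Finset.sum_congr rfl fun i _ => ?_
    rw [← sub_mul, ← Complex.ofReal_sub, Pi.neg_apply]
    congr 2
    rcases le_total 0 (r i) with h0 | h0
    · rw [max_eq_left h0, max_eq_right (by linarith), sub_zero]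
    · rw [max_eq_right h0, max_eq_left (by linarith)]; ring
  have e : m r = m (-r) := by
    refine measure_ext_of_char _ _ fun a => sub_eq_zero.1 ?_
    rw [hdiff _ fun i => integrable_char a _, h a]
  rw [← hdiff f fun i => Integrable.of_bound hf.aestronglyMeasurable M (ae_of_all _ hM), e, sub_self]

/-- A complex linear combination of finite Borel measures on the spectrum which annihilates the
Gelfand transforms annihilates all bounded Borel functions. -/
theorem sum_integral_eq_zero [TopologicalSpace.SeparableSpace C] {ι : Type*} [Fintype ι]
    (c : ι → ℂ) (μ : ι → FiniteMeasure (characterSpace ℂ C))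
    (h : ∀ a : C, ∑ i, c i * ∫ χ, χ a ∂(μ i : Measure (characterSpace ℂ C)) = 0)
    (f : characterSpace ℂ C → ℂ) (hf : Measurable f) (M : ℝ) (hM : ∀ χ, ‖f χ‖ ≤ M) :
    ∑ i, c i * ∫ χ, f χ ∂(μ i : Measure (characterSpace ℂ C)) = 0 := by
  have hconj (a : C) :
      ∑ i, conj (c i) * ∫ χ, χ a ∂(μ i : Measure (characterSpace ℂ C)) = 0 := by
    have := congrArg conj (h (star a))
    simpa [map_sum, char_star, integral_conj] using this
  have hre := real_sum_integral_eq_zero (fun i => (c i).re) μ (fun a => by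
    have h2 : ∀ i, ((c i).re : ℂ) = (c i + conj (c i)) / 2 := fun i => by
      rw [Complex.add_conj]; simp
    have := congrArg (fun z : ℂ => z / 2) (congrArg₂ (· + ·) (h a) (hconj a))
    simp only [← Finset.sum_add_distrib, ← add_mul, Finset.sum_div] at this
    simp only [h2]
    rw [add_zero, zero_div] at this
    rw [← this]
    exact Finset.sum_congr rfl fun i _ => by ring) f hf M hM
  have him := real_sum_integral_eq_zero (fun i => (c i).im) μ (fun a => by
    have h2 : ∀ i, ((c i).im : ℂ) = (c i - conj (c i)) / (2 * Complex.I) := fun i => by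
      rw [Complex.sub_conj]; field_simp; push_cast; ring
    have := congrArg (fun z : ℂ => z / (2 * Complex.I)) (congrArg₂ (· - ·) (h a) (hconj a))
    simp only [← Finset.sum_sub_distrib, ← sub_mul, Finset.sum_div] at this
    simp only [h2]
    rw [sub_zero, zero_div] at this
    rw [← this]
    exact Finset.sum_congr rfl fun i _ => by ring) f hf M hM
  have : ∀ i, c i * ∫ χ, f χ ∂(μ i : Measure (characterSpace ℂ C)) =
      ((c i).re : ℂ) * ∫ χ, f χ ∂(μ i : Measure (characterSpace ℂ C)) +
      Complex.I * (((c i).im : ℂ) * ∫ χ, f χ ∂(μ i : Measure (characterSpace ℂ C))) := fun i => by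
    conv_lhs => rw [← Complex.re_add_im (c i)]
    ring
  simp only [this, Finset.sum_add_distrib, ← Finset.mul_sum, hre, him, mul_zero, add_zero]

/-- The complex measure `μ 0 + i μ 1 - μ 2 - i μ 3` represents the functional `ψ`. -/
def Represents (μ : Fin 4 → FiniteMeasure (characterSpace ℂ C)) (ψ : StrongDual ℂ C) : Prop :=
  ∀ a : C, ψ a =
    ∑ k : Fin 4, Complex.I ^ (k : ℕ) * ∫ χ, χ a ∂(μ k : Measure (characterSpace ℂ C))

theorem exists_represents (ψ : StrongDual ℂ C) :
    ∃ μ : Fin 4 → FiniteMeasure (characterSpace ℂ C), Represents μ ψ ∧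
      ∀ k, (μ k : Measure (characterSpace ℂ C)).real Set.univ ≤ ‖ψ‖ := by
  let K := characterSpace ℂ (Unitization ℂ C)
  let inr : C →ₗᵢ[ℂ] Unitization ℂ C := ⟨Unitization.inrHom ℂ ℂ C, Unitization.norm_inr⟩
  obtain ⟨Ψ, hΨ, hΨn⟩ := exists_extension_norm_eq (LinearMap.range inr.toLinearMap)
    (ψ.comp (inr.equivRange.symm.toContinuousLinearEquiv : _ →L[ℂ] C))
  have hΨ' (a : C) : Ψ (a : Unitization ℂ C) = ψ a := by
    have := hΨ (inr.equivRange a)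
    rw [ContinuousLinearMap.comp_apply] at this
    exact this.trans (congrArg ψ (inr.equivRange.symm_apply_apply a))
  have hΨ'n : ‖Ψ‖ ≤ ‖ψ‖ := by
    rw [hΨn]
    refine ContinuousLinearMap.opNorm_le_bound _ (norm_nonneg _) fun x => ?_
    refine (ψ.le_opNorm _).trans_eq ?_
    congr 1
    exact inr.equivRange.symm.norm_map x
  let G := gelfandStarTransform (Unitization ℂ C)
  have hG (g : C(K, ℂ)) : ‖G.symm g‖ = ‖g‖ := by
    have := (gelfandTransform_isometry (Unitization ℂ C)).norm_map_of_map_zero (map_zero _) (G.symm g)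
    rw [← this]
    exact congrArg norm (G.apply_symm_apply g)
  let cpx : C(K, ℝ) →ₗ[ℝ] C(K, ℂ) :=
  { toFun h := ⟨fun κ => (h κ : ℂ), by fun_prop⟩
    map_add' _ _ := by ext; simp
    map_smul' _ _ := by ext; simp }
  have hcpx (h : C(K, ℝ)) : ‖cpx h‖ ≤ ‖h‖ :=
    (ContinuousMap.norm_le _ (norm_nonneg _)).2 fun κ => by
      simpa [cpx] using h.norm_coe_le_norm κ
  let T : C(K, ℝ) →ₗ[ℝ] ℂ :=
  { toFun h := Ψ (G.symm (cpx h))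
    map_add' _ _ := by simp
    map_smul' r h := by
      have : cpx (r • h) = (r : ℂ) • cpx h := by ext; simp [cpx]
      rw [this, map_smul, map_smul]; simp }
  have hT (h : C(K, ℝ)) : ‖T h‖ ≤ ‖ψ‖ * ‖h‖ := by
    calc ‖T h‖ ≤ ‖Ψ‖ * ‖G.symm (cpx h)‖ := Ψ.le_opNorm _
      _ ≤ ‖ψ‖ * ‖h‖ := by rw [hG]; gcongr; exact hcpx h
  obtain ⟨ν₀, ν₂, f₀, f₂, m₀, m₂, h02⟩ := exists_measures_of_bounded (Complex.reLm ∘ₗ T) ‖ψ‖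
    (norm_nonneg _) fun h => (Complex.re_le_norm _).trans (hT h)
  obtain ⟨ν₁, ν₃, f₁, f₃, m₁, m₃, h13⟩ := exists_measures_of_bounded (Complex.imLm ∘ₗ T) ‖ψ‖
    (norm_nonneg _) fun h => ((le_abs_self _).trans (Complex.abs_im_le_norm _)).trans (hT h)
  have hj := measurableEmbedding_charExt (C := C)
  let ν : Fin 4 → Measure K := ![ν₀, ν₁, ν₂, ν₃]
  have hν (k : Fin 4) : IsFiniteMeasure (ν k) := by fin_cases k <;> assumption
  have hνm (k : Fin 4) : (ν k).real Set.univ ≤ ‖ψ‖ := by fin_cases k <;> assumption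
  have hle (k : Fin 4) : ((ν k).comap charExt) Set.univ ≤ (ν k) Set.univ := by
    rw [hj.comap_apply]; exact measure_mono (Set.subset_univ _)
  have hfin (k : Fin 4) : IsFiniteMeasure ((ν k).comap (charExt (C := C))) :=
    ⟨(hle k).trans_lt (measure_lt_top _ _)⟩
  refine ⟨fun k => ⟨(ν k).comap charExt, hfin k⟩, fun a => ?_, fun k => ?_⟩
  · have hcomap (k : Fin 4) : ∫ χ, χ a ∂((ν k).comap (charExt (C := C))) =
        ∫ κ, κ (a : Unitization ℂ C) ∂(ν k) := by
      have h1 : ∫ χ, χ a ∂((ν k).comap (charExt (C := C))) =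
          ∫ χ, charExt χ (a : Unitization ℂ C) ∂((ν k).comap (charExt (C := C))) := by
        simp only [charExt_inr]
      rw [h1, ← hj.integral_map (fun κ : K => κ (a : Unitization ℂ C)), hj.map_comap]
      refine setIntegral_eq_integral_of_forall_compl_eq_zero fun κ hκ => ?_
      rw [← charRes_apply]
      have : charRes κ = 0 := by
        by_contra h0
        exact hκ (mem_range_charExt h0)
      rw [this]; rfl
    simp only [FiniteMeasure.toMeasure_mk, hcomap]
    let g : C(K, ℂ) := G (a : Unitization ℂ C)
    let u : C(K, ℝ) := ⟨fun κ => (g κ).re, by fun_prop⟩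
    let v : C(K, ℝ) := ⟨fun κ => (g κ).im, by fun_prop⟩
    have hg : g = cpx u + Complex.I • cpx v := by
      ext κ
      simp only [cpx, u, v, ContinuousMap.add_apply, ContinuousMap.smul_apply, smul_eq_mul]
      exact (Complex.re_add_im (g κ)).symm.trans (by rw [mul_comm]; rfl)
    have hψ : ψ a = T u + Complex.I * T v := by
      rw [← hΨ', ← G.symm_apply_apply (a : Unitization ℂ C)]
      change Ψ (G.symm g) = _
      rw [hg, map_add, map_smul, map_add, map_smul]
      rfl
    have hTe (h : C(K, ℝ)) : T h = ((∫ κ, h κ ∂ν₀ - ∫ κ, h κ ∂ν₂ : ℝ) : ℂ) +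
        ((∫ κ, h κ ∂ν₁ - ∫ κ, h κ ∂ν₃ : ℝ) : ℂ) * Complex.I := by
      rw [← h02, ← h13]
      exact (Complex.re_add_im (T h)).symm
    have hint (k : Fin 4) : ∫ κ, κ (a : Unitization ℂ C) ∂(ν k) =
        ((∫ κ, u κ ∂(ν k) : ℝ) : ℂ) + Complex.I * ((∫ κ, v κ ∂(ν k) : ℝ) : ℂ) := by
      have hi (h : C(K, ℝ)) : Integrable (fun κ => ((h κ : ℝ) : ℂ)) (ν k) :=
        (h.continuous.integrable_of_hasCompactSupport
          (HasCompactSupport.of_compactSpace _)).ofReal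
      rw [← integral_complex_ofReal, ← integral_complex_ofReal, ← integral_const_mul,
        ← integral_add (hi u) ((hi v).const_mul _)]
      refine integral_congr_ae (ae_of_all _ fun κ => ?_)
      exact DFunLike.congr_fun hg κ
    simp only [hint, hψ, hTe, Fin.sum_univ_four, ν]
    simp [pow_succ]
    ring_nf
  · refine le_trans ?_ (hνm k)
    exact ENNReal.toReal_mono (measure_ne_top _ _) (hle k)

end

/-! ### The C⋆-algebra of bounded Borel functions -/

/-- The bounded complex-valued Borel functions on `X`, as a ⋆-subalgebra of `ℓ^∞(X)`. -/
def boundedBorel (X : Type*) [MeasurableSpace X] : StarSubalgebra ℂ (lp (fun _ : X => ℂ) ∞) where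
  carrier := {f | Measurable (f : X → ℂ)}
  mul_mem' hf hg := by
    simp only [Set.mem_ofPred_eq, lp.infty_coeFn_mul] at *
    exact hf.mul hg
  one_mem' := measurable_const
  add_mem' hf hg := by
    simp only [Set.mem_ofPred_eq, lp.coeFn_add] at *
    exact hf.add hg
  zero_mem' := measurable_const
  algebraMap_mem' c := by
    rw [Set.mem_ofPred_eq, Algebra.algebraMap_eq_smul_one, lp.coeFn_smul, lp.infty_coeFn_one]
    exact measurable_const (a := c • (1 : ℂ))
  star_mem' hf := by
    simp only [Set.mem_ofPred_eq, lp.coeFn_star] at *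
    exact Complex.continuous_conj.measurable.comp hf

instance boundedBorel.instIsClosed (X : Type*) [MeasurableSpace X] :
    IsClosed (boundedBorel X : Set (lp (fun _ : X => ℂ) ∞)) := by
  refine IsSeqClosed.isClosed fun u f hu hf => ?_
  refine measurable_of_tendsto_metrizable (f := fun n => (u n : X → ℂ)) hu ?_
  rw [tendsto_pi_nhds]
  exact fun x => ((lp.lipschitzWith_one_eval (E := fun _ : X => ℂ) ∞ x).continuous.tendsto f).comp hf

/-- `B(X)`, the C⋆-algebra of bounded Borel functions on `X` with pointwise operations and the
supremum norm. -/
def BoundedBorel (X : Type*) [MeasurableSpace X] : Type _ := boundedBorel X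

namespace BoundedBorel

variable {X : Type*} [MeasurableSpace X]

instance : CommCStarAlgebra (BoundedBorel X) :=
  inferInstanceAs (CommCStarAlgebra (boundedBorel X))

instance : CoeFun (BoundedBorel X) fun _ => X → ℂ := ⟨fun f => (f.1 : X → ℂ)⟩

theorem measurable (f : BoundedBorel X) : Measurable (f : X → ℂ) := f.2

theorem norm_apply_le (f : BoundedBorel X) (x : X) : ‖f x‖ ≤ ‖f‖ :=
  lp.norm_apply_le_norm ENNReal.top_ne_zero f.1 x

theorem add_apply (f g : BoundedBorel X) (x : X) : (f + g) x = f x + g x := rfl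

theorem smul_apply (c : ℂ) (f : BoundedBorel X) (x : X) : (c • f) x = c * f x := rfl

open scoped ComplexOrder

/-- The pointwise order. -/
instance : PartialOrder (BoundedBorel X) :=
  PartialOrder.lift (fun f : BoundedBorel X => (f : X → ℂ))
    fun _ _ h => Subtype.ext (lp.ext h)

theorem le_def (f g : BoundedBorel X) : f ≤ g ↔ ∀ x, f x ≤ g x := Iff.rfl

instance : StarOrderedRing (BoundedBorel X) := by
  refine StarOrderedRing.of_nonneg_iff' (R := BoundedBorel X) (fun {f g} h k x => ?_) fun f => ⟨fun h => ?_, ?_⟩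
  · exact add_le_add_right (h x) (k x)
  · have hr (x : X) : ((f x).re : ℂ) = f x := by
      have := h x
      exact Complex.ext rfl (Complex.le_def.1 this).2
    have hn (x : X) : 0 ≤ (f x).re := (Complex.le_def.1 (h x)).1
    let s : X → ℂ := fun x => (Real.sqrt (f x).re : ℂ)
    have hs : Memℓp s ∞ := memℓp_infty ⟨Real.sqrt ‖f‖, by
      rintro _ ⟨x, rfl⟩
      simp only [s, Complex.norm_real, Real.norm_eq_abs, abs_of_nonneg (Real.sqrt_nonneg _)]
      exact Real.sqrt_le_sqrt ((Complex.re_le_norm _).trans (f.norm_apply_le x))⟩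
    have hsm : Measurable s :=
      Complex.measurable_ofReal.comp (Complex.measurable_re.comp f.measurable).sqrt
    refine ⟨⟨⟨s, hs⟩, hsm⟩, Subtype.ext (lp.ext (funext fun x => ?_))⟩
    change f x = star (s x) * s x
    simp only [s, Complex.star_def, Complex.conj_ofReal, ← Complex.ofReal_mul,
      Real.mul_self_sqrt (hn x), hr]
  · rintro ⟨s, rfl⟩ x
    exact star_mul_self_nonneg (s x)

end BoundedBorel

/-! ### Biduals -/

/-- The bidual `E**` of a complex normed space. -/
abbrev Bidual (E : Type*) [SeminormedAddCommGroup E] [NormedSpace ℂ E] : Type _ :=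
  StrongDual ℂ (StrongDual ℂ E)

/-- The second adjoint `φ** : E** → F**`. -/
def ContinuousLinearMap.bidual {E F : Type*} [SeminormedAddCommGroup E] [NormedSpace ℂ E]
    [SeminormedAddCommGroup F] [NormedSpace ℂ F] (φ : E →L[ℂ] F) : Bidual E →L[ℂ] Bidual F :=
  (φ.precomp ℂ).precomp ℂ

section Arens

variable {B : Type*} [NonUnitalCStarAlgebra B]

/-- The functional `y · ψ : b ↦ y (c ↦ ψ (b c))` on `B`, for `y ∈ B**` and `ψ ∈ B*`. -/
def arensAct (y : Bidual B) : StrongDual ℂ B →L[ℂ] StrongDual ℂ B :=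
  (ContinuousLinearMap.compL ℂ B (StrongDual ℂ B) ℂ y).comp
    (((ContinuousLinearMap.compL ℂ B (B →L[ℂ] B) (StrongDual ℂ B)).flip
      (ContinuousLinearMap.mul ℂ B)).comp (ContinuousLinearMap.compL ℂ B B ℂ))

/-- The product of the C⋆-algebra `B**`, given by the Arens product
`(x y)(ψ) = x (b ↦ y (c ↦ ψ (b c)))`. -/
instance Bidual.instMul : Mul (Bidual B) := ⟨fun x y => x.comp (arensAct y)⟩

theorem arensAct_apply (y : Bidual B) (ψ : StrongDual ℂ B) (b : B) :
    arensAct y ψ b = y (ψ.comp (ContinuousLinearMap.mul ℂ B b)) := rfl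

theorem Bidual.mul_apply (x y : Bidual B) (ψ : StrongDual ℂ B) :
    (x * y) ψ = x (arensAct y ψ) := rfl

end Arens

/-! ### The bounded Borel functions inside the bidual -/

section

variable {C : Type*} [NonUnitalCommCStarAlgebra C]

/-- The integral of a bounded Borel function on the spectrum of `C` against the complex measure
representing `ψ`. -/
def borelPairing (f : BoundedBorel (characterSpace ℂ C)) (ψ : StrongDual ℂ C) : ℂ :=
  ∑ k : Fin 4, Complex.I ^ (k : ℕ) *
    ∫ χ, f χ ∂((exists_represents ψ).choose k : Measure (characterSpace ℂ C))

theorem integrable_borel (f : BoundedBorel (characterSpace ℂ C))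
    (μ : Measure (characterSpace ℂ C)) [IsFiniteMeasure μ] : Integrable (fun χ => f χ) μ :=
  Integrable.of_bound f.measurable.aestronglyMeasurable ‖f‖ (ae_of_all _ f.norm_apply_le)

theorem norm_borelPairing_le (f : BoundedBorel (characterSpace ℂ C)) (ψ : StrongDual ℂ C) :
    ‖borelPairing f ψ‖ ≤ 4 * ‖f‖ * ‖ψ‖ := by
  obtain ⟨-, hm⟩ := (exists_represents ψ).choose_spec
  have key (k : Fin 4) : ‖Complex.I ^ (k : ℕ) *
      ∫ χ, f χ ∂((exists_represents ψ).choose k : Measure (characterSpace ℂ C))‖ ≤ ‖f‖ * ‖ψ‖ := by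
    rw [norm_mul, norm_pow, Complex.norm_I, one_pow, one_mul]
    refine (norm_integral_le_of_norm_le_const (ae_of_all _ f.norm_apply_le)).trans ?_
    gcongr
    exact hm k
  refine (norm_sum_le_of_le _ fun k _ => key k).trans_eq ?_
  simp; ring

theorem sum_borelPairing_eq_zero [TopologicalSpace.SeparableSpace C] {ι : Type*} [Fintype ι]
    (f : BoundedBorel (characterSpace ℂ C)) (c : ι → ℂ) (ψ : ι → StrongDual ℂ C)
    (h : ∑ i, c i • ψ i = 0) : ∑ i, c i * borelPairing f (ψ i) = 0 := by
  have := sum_integral_eq_zero (fun p : ι × Fin 4 => c p.1 * Complex.I ^ (p.2 : ℕ))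
    (fun p => (exists_represents (ψ p.1)).choose p.2) (fun a => ?_) f f.measurable ‖f‖
    f.norm_apply_le
  · rw [Fintype.sum_prod_type] at this
    simpa only [borelPairing, Finset.mul_sum, mul_assoc] using this
  · rw [Fintype.sum_prod_type]
    simp only [mul_assoc, ← Finset.mul_sum]
    have h' := DFunLike.congr_fun h a
    simp only [sum_apply, smul_apply, smul_eq_mul] at h'
    refine Eq.trans (Finset.sum_congr rfl fun i _ => ?_) h'
    rw [← (exists_represents (ψ i)).choose_spec.1 a]

theorem borelPairing_add_left (f g : BoundedBorel (characterSpace ℂ C)) (ψ : StrongDual ℂ C) :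
    borelPairing (f + g) ψ = borelPairing f ψ + borelPairing g ψ := by
  simp only [borelPairing, BoundedBorel.add_apply, ← Finset.sum_add_distrib, ← mul_add]
  refine Finset.sum_congr rfl fun k _ => ?_
  rw [← integral_add (integrable_borel f _) (integrable_borel g _)]

theorem borelPairing_smul_left (c : ℂ) (f : BoundedBorel (characterSpace ℂ C))
    (ψ : StrongDual ℂ C) : borelPairing (c • f) ψ = c • borelPairing f ψ := by
  simp only [borelPairing, BoundedBorel.smul_apply, smul_eq_mul, Finset.mul_sum]
  refine Finset.sum_congr rfl fun k _ => ?_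
  rw [mul_left_comm, ← integral_const_mul c]

theorem borelPairing_add_right [TopologicalSpace.SeparableSpace C]
    (f : BoundedBorel (characterSpace ℂ C)) (ψ ψ' : StrongDual ℂ C) :
    borelPairing f (ψ + ψ') = borelPairing f ψ + borelPairing f ψ' := by
  have := sum_borelPairing_eq_zero f ![1, -1, -1] ![ψ + ψ', ψ, ψ']
    (by
      ext a
      simp only [Fin.sum_univ_three, add_apply, smul_apply, smul_eq_mul, Matrix.cons_val,
        zero_apply]
      ring)
  simp [Fin.sum_univ_three] at this
  linear_combination this

theorem borelPairing_smul_right [TopologicalSpace.SeparableSpace C] (c : ℂ)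
    (f : BoundedBorel (characterSpace ℂ C)) (ψ : StrongDual ℂ C) :
    borelPairing f (c • ψ) = c • borelPairing f ψ := by
  have := sum_borelPairing_eq_zero f ![1, -c] ![c • ψ, ψ]
    (by
      ext a
      simp only [Fin.sum_univ_two, add_apply, smul_apply, smul_eq_mul, Matrix.cons_val, zero_apply]
      ring)
  simp at this
  rw [smul_eq_mul]
  linear_combination this

/-- The canonical map `B(σ(C)) → C**`: a bounded Borel function `f` is sent to the functional
`ψ ↦ ∫ f dμ_ψ` on `C*`, where `μ_ψ` is the complex Borel measure on `σ(C)` which represents `ψ`. -/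
def borelBidual (C : Type*) [NonUnitalCommCStarAlgebra C] [TopologicalSpace.SeparableSpace C] :
    BoundedBorel (characterSpace ℂ C) →L[ℂ] Bidual C :=
  LinearMap.mkContinuous₂
    (LinearMap.mk₂ ℂ borelPairing borelPairing_add_left borelPairing_smul_left
      borelPairing_add_right fun c f ψ => borelPairing_smul_right c f ψ)
    4 norm_borelPairing_le

/-- The value of `borelBidual C f` at `ψ` is computed with any measure representing `ψ`. -/
theorem borelBidual_apply [TopologicalSpace.SeparableSpace C]
    (f : BoundedBorel (characterSpace ℂ C)) (ψ : StrongDual ℂ C)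
    (μ : Fin 4 → FiniteMeasure (characterSpace ℂ C)) (h : Represents μ ψ) :
    borelBidual C f ψ = ∑ k : Fin 4, Complex.I ^ (k : ℕ) *
      ∫ χ, f χ ∂(μ k : Measure (characterSpace ℂ C)) := by
  have := sum_integral_eq_zero
    (Sum.elim (fun k : Fin 4 => Complex.I ^ (k : ℕ)) (fun k : Fin 4 => -Complex.I ^ (k : ℕ)))
    (Sum.elim (exists_represents ψ).choose μ) (fun a => ?_) f f.measurable ‖f‖ f.norm_apply_le
  · simp only [Fintype.sum_sum_type, Sum.elim_inl, Sum.elim_inr, neg_mul,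
      Finset.sum_neg_distrib] at this
    exact sub_eq_zero.1 ((sub_eq_add_neg _ _).trans this)
  · simp only [Fintype.sum_sum_type, Sum.elim_inl, Sum.elim_inr, neg_mul, Finset.sum_neg_distrib]
    rw [← (exists_represents ψ).choose_spec.1 a, ← h a, add_neg_cancel]

end

section

variable {A : Type*} [NonUnitalCStarAlgebra A] (A₀ : NonUnitalStarSubalgebra ℂ A)
  [IsClosed (A₀ : Set A)] [IsMulCommutative A₀]

/-- A norm-closed commutative ⋆-subalgebra of a C⋆-algebra is a commutative C⋆-algebra. -/
instance NonUnitalStarSubalgebra.instNonUnitalCommCStarAlgebra : NonUnitalCommCStarAlgebra A₀ where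
  __ := (inferInstance : NonUnitalCStarAlgebra A₀)
  mul_comm := IsMulCommutative.is_comm.comm

/-- The inclusion `B(σ(A₀)) ⊆ A**`, the composition of `B(σ(A₀)) ⊆ A₀**` with the second adjoint
of the inclusion `A₀ ⊆ A`. -/
def borelInclusion [TopologicalSpace.SeparableSpace A₀] :
    BoundedBorel (characterSpace ℂ A₀) →L[ℂ] Bidual A :=
  (ContinuousLinearMap.bidual (⟨A₀.subtype, continuous_subtype_val⟩ : A₀ →L[ℂ] A)).comp
    (borelBidual A₀)

end

/-! ### Approximately order zero maps -/

/-- Orthogonality `x ⊥ y` in a C⋆-algebra. -/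
def Orthogonal {A : Type*} [NonUnitalCStarAlgebra A] (x y : A) : Prop :=
  x * y = 0 ∧ y * x = 0 ∧ star x * y = 0 ∧ x * star y = 0

/-- A bounded linear map `φ` is `ε`-order zero if `‖φ x φ y‖ ≤ ε ‖x‖ ‖y‖` for all positive
`x ⊥ y`. -/
def IsEpsOrderZero {A E : Type*} [NonUnitalCStarAlgebra A] [PartialOrder A] [StarOrderedRing A]
    [NormedAddCommGroup E] [NormedSpace ℂ E] [Mul E] (ε : ℝ) (φ : A →L[ℂ] E) : Prop :=
  ∀ x y : A, 0 ≤ x → 0 ≤ y → Orthogonal x y → ‖φ x * φ y‖ ≤ ε * ‖x‖ * ‖y‖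

end

/-! The Arens product `(f, g) ↦ φ** f * φ** g` at `ξ` integrates `f` against the functional
`Ψ : a ↦ (φ** g) (ξ (φ a * φ ·))`, and a measure is determined by its values on compact sets, so `f`
can be truncated to a compact subset of its support. Truncating `g` to a compact set is the
difficulty: it must be done uniformly over all the functionals `c ↦ ξ (b * φ c)`, `‖b‖ ≤ R`. For
orthogonal self-adjoint contractions `c i` all signed sums of the `φ (c i)` have norm at most `‖φ‖`;
averaging over the signs bounds the column `∑ star (φ (c i)) * φ (c i)`, and by row-column
Cauchy-Schwarz `n` of the numbers `‖ξ (b i * φ (c i))‖` have sum `O(√n)`. They cannot all exceed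
`δ > 0` when `n` is large, which makes the measures of these functionals uniformly inner regular.
Finally, disjoint compact sets have disjoint open neighbourhoods, so truncations of `f` and `g` to
them are approximated by orthogonal positive elements of `A₀`, to which the hypothesis applies. -/

noncomputable section

open MeasureTheory WeakDual ComplexConjugate TopologicalSpace
open scoped ENNReal Function

section CStarAlgebra

variable {ι A B : Type*} [NonUnitalCStarAlgebra A] [NonUnitalCStarAlgebra B]

/- Averaging `star z * z` over the two choices of sign in `z = y ± c j` removes the cross terms. -/
theorem norm_star_mul_self_add_sum_le (s : Finset ι) (c : ι → B) {M : ℝ} (y : B)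
    (h : ∀ e : ι → ℤˣ, ‖y + ∑ i ∈ s, (e i : ℤ) • c i‖ ≤ M) :
    ‖star y * y + ∑ i ∈ s, star (c i) * c i‖ ≤ M ^ 2 := by
  classical
  induction s using Finset.induction_on generalizing y with
  | empty =>
    have hy : ‖y‖ ≤ M := by simpa using h 1
    simpa [CStarRing.norm_star_mul_self, sq] using mul_self_le_mul_self (norm_nonneg y) hy
  | insert j s hj ih =>
    have h_sign (u : ℤˣ) :
        ‖star (y + (u : ℤ) • c j) * (y + (u : ℤ) • c j) + ∑ i ∈ s, star (c i) * c i‖ ≤ M ^ 2 := by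
      refine ih _ fun e => le_of_eq_of_le ?_ (h (Function.update e j u))
      rw [Finset.sum_insert hj, Function.update_self, add_assoc]
      congr 3
      exact Finset.sum_congr rfl fun i hi => by
        rw [Function.update_of_ne (ne_of_mem_of_not_mem hi hj)]
    have parallelogram : (2 : ℂ) • (star y * y + ∑ i ∈ insert j s, star (c i) * c i) =
        (star (y + ((1 : ℤˣ) : ℤ) • c j) * (y + ((1 : ℤˣ) : ℤ) • c j) +
            ∑ i ∈ s, star (c i) * c i) +
          (star (y + ((-1 : ℤˣ) : ℤ) • c j) * (y + ((-1 : ℤˣ) : ℤ) • c j) +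
            ∑ i ∈ s, star (c i) * c i) := by
      rw [Finset.sum_insert hj, two_smul]
      simp only [Units.val_one, Units.val_neg, one_smul, neg_smul, star_add, star_neg, mul_add,
        add_mul, neg_mul, mul_neg]
      abel
    have h_double := norm_add_le_of_le (h_sign 1) (h_sign (-1))
    rw [← parallelogram, norm_smul, Complex.norm_ofNat] at h_double
    linarith

theorem norm_sum_mul_le_sqrt_mul_sqrt [Fintype ι] (b c : ι → B) :
    ‖∑ i, b i * c i‖ ≤ √‖∑ i, b i * star (b i)‖ * √‖∑ i, star (c i) * c i‖ := by
  let _ : PartialOrder B := CStarAlgebra.spectralOrder B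
  have _ : StarOrderedRing B := CStarAlgebra.spectralOrderedRing B
  let x : WithCStarModule B (ι → B) := (WithCStarModule.equiv B (ι → B)).symm fun i => star (c i)
  let y : WithCStarModule B (ι → B) := (WithCStarModule.equiv B (ι → B)).symm b
  have cauchy_schwarz := CStarModule.norm_inner_le (A := B) (WithCStarModule B (ι → B))
    (x := x) (y := y)
  simp only [WithCStarModule.pi_inner, WithCStarModule.pi_norm, WithCStarModule.inner_def, x, y,
    WithCStarModule.equiv_symm_pi_apply, star_star] at cauchy_schwarz
  rwa [mul_comm]

theorem sum_norm_apply_mul_le [Fintype ι] (ξ : StrongDual ℂ B) (b c : ι → B) {R M : ℝ}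
    (hb : ∀ i, ‖b i‖ ≤ R) (hc : ∀ e : ι → ℤˣ, ‖∑ i, (e i : ℤ) • c i‖ ≤ M) :
    ∑ i, ‖ξ (b i * c i)‖ ≤ ‖ξ‖ * (√(Fintype.card ι * R ^ 2) * M) := by
  choose u hu hξu using fun i => RCLike.exists_norm_eq_mul_self (ξ (b i * c i))
  have h_eq : ((∑ i, ‖ξ (b i * c i)‖ : ℝ) : ℂ) = ξ (∑ i, (u i • b i) * c i) := by
    simp only [map_sum, smul_mul_assoc, map_smul, smul_eq_mul, Complex.ofReal_sum, ← hξu,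
      Complex.coe_algebraMap]
  have h_row : ‖∑ i, (u i • b i) * star (u i • b i)‖ ≤ Fintype.card ι * R ^ 2 := by
    refine (norm_sum_le_of_le _ (n := fun _ => R ^ 2) fun i _ => ?_).trans_eq (by simp)
    rw [CStarRing.norm_self_mul_star, norm_smul, hu, one_mul, sq]
    exact mul_self_le_mul_self (norm_nonneg _) (hb i)
  have h_column : ‖∑ i, star (c i) * c i‖ ≤ M ^ 2 := by
    simpa using norm_star_mul_self_add_sum_le (M := M) Finset.univ c 0 (by simpa using hc)
  have hM : 0 ≤ M := (norm_nonneg _).trans (hc 1)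
  calc ∑ i, ‖ξ (b i * c i)‖ = ‖ξ (∑ i, (u i • b i) * c i)‖ := by
        rw [← h_eq, Complex.norm_real, Real.norm_of_nonneg (by positivity)]
    _ ≤ ‖ξ‖ * ‖∑ i, (u i • b i) * c i‖ := ξ.le_opNorm _
    _ ≤ ‖ξ‖ * (√(Fintype.card ι * R ^ 2) * M) := by
        gcongr
        refine (norm_sum_mul_le_sqrt_mul_sqrt _ _).trans ?_
        gcongr
        exact (Real.sqrt_le_left hM).2 h_column

theorem norm_sum_units_zsmul_le [Fintype ι] {c : ι → A} {M : ℝ} (hM : 0 ≤ M)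
    (hsa : ∀ i, IsSelfAdjoint (c i)) (hc : ∀ i, ‖c i‖ ≤ M) (hmul : Pairwise ((· * · = 0) on c))
    (e : ι → ℤˣ) : ‖∑ i, (e i : ℤ) • c i‖ ≤ M := by
  have h_norm (i : ι) : ‖(e i : ℤ) • c i‖ = ‖c i‖ := by
    rcases Int.units_eq_one_or (e i) with h | h <;> simp [h]
  have h_sa (i : ι) : IsSelfAdjoint ((e i : ℤ) • c i) := by
    rcases Int.units_eq_one_or (e i) with h | h <;> simp [h, hsa i, (hsa i).neg]
  have h_mul : Pairwise ((· * · = 0) on fun i => (e i : ℤ) • c i) := fun i j hij => by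
    have h_zero : c i * c j = 0 := hmul hij
    rw [Function.onFun, smul_mul_assoc, mul_smul_comm, h_zero, smul_zero, smul_zero]
  lift M to NNReal using hM
  rw [← coe_nnnorm, NNReal.coe_le_coe, IsSelfAdjoint.nnnorm_sum_eq_sup _ (fun i _ => h_sa i) h_mul]
  refine Finset.sup_le fun i _ => ?_
  rw [← NNReal.coe_le_coe, coe_nnnorm, h_norm]
  exact hc i

/-- Uniform exhaustivity of a set `𝒦` of functionals on a C⋆-algebra: no bounded family of pairwise
orthogonal self-adjoint elements on which members of `𝒦` take values of size at least `δ` has more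
than a fixed number of elements. For the measures represented by functionals on a commutative
C⋆-algebra this is uniform countable additivity. -/
def UniformlyExhaustive (𝒦 : Set (StrongDual ℂ A)) : Prop :=
  ∀ M δ : ℝ, 0 < δ → ∃ n : ℕ, ∀ (β : Fin n → StrongDual ℂ A) (c : Fin n → A),
    (∀ i, β i ∈ 𝒦) → (∀ i, IsSelfAdjoint (c i)) → (∀ i, ‖c i‖ ≤ M) →
      Pairwise ((· * · = 0) on c) → ∃ i, ‖β i (c i)‖ < δ

theorem uniformlyExhaustive_image_closedBall (φ : A →L[ℂ] B) (ξ : StrongDual ℂ B) (R : ℝ) :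
    UniformlyExhaustive ((fun b : B => (ξ.comp (ContinuousLinearMap.mul ℂ B b)).comp φ) ''
      Metric.closedBall 0 R) := by
  intro M δ hδ
  obtain ⟨N, hN⟩ := exists_nat_gt (‖ξ‖ * (|R| * (‖φ‖ * |M|)) / δ)
  refine ⟨N ^ 2, fun β c hβ hsa hc hmul => ?_⟩
  choose b hb hbβ using hβ
  by_contra! h_large
  have h_signed (e : Fin (N ^ 2) → ℤˣ) : ‖∑ i, (e i : ℤ) • φ (c i)‖ ≤ ‖φ‖ * |M| := by
    have h_sum := norm_sum_units_zsmul_le (abs_nonneg M) hsa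
      (fun i => (hc i).trans (le_abs_self M)) hmul e
    simpa only [map_sum, map_zsmul] using φ.le_opNorm_of_le h_sum
  have h_upper := sum_norm_apply_mul_le ξ b (fun i => φ (c i))
    (fun i => mem_closedBall_zero_iff.1 (hb i)) h_signed
  have h_lower : (N ^ 2 : ℕ) * δ ≤ ∑ i, ‖ξ (b i * φ (c i))‖ := by
    simpa [← hbβ] using Finset.card_nsmul_le_sum Finset.univ _ δ fun i _ => h_large i
  have hN_pos : 0 < (N : ℝ) := lt_of_le_of_lt (by positivity) hN
  rw [div_lt_iff₀ hδ] at hN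
  rw [Fintype.card_fin, Nat.cast_pow, ← mul_pow, Real.sqrt_sq_eq_abs, abs_mul,
    Nat.abs_cast] at h_upper
  rw [Nat.cast_pow] at h_lower
  nlinarith

end CStarAlgebra

section Spectrum

variable {C : Type*} [NonUnitalCommCStarAlgebra C]

theorem isOpenEmbedding_charExt : Topology.IsOpenEmbedding
    (charExt : characterSpace ℂ C → characterSpace ℂ (Unitization ℂ C)) := by
  have h_comp : charRes ∘ (charExt : characterSpace ℂ C → characterSpace ℂ (Unitization ℂ C)) =
      Subtype.val := funext charRes_charExt
  refine ⟨.of_comp continuous_charExt continuous_charRes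
    (h_comp ▸ Topology.IsEmbedding.subtypeVal), ?_⟩
  rw [range_charExt]
  exact isOpen_compl_singleton.preimage continuous_charRes

instance : LocallyCompactSpace (characterSpace ℂ C) :=
  isOpenEmbedding_charExt.locallyCompactSpace

instance : T2Space (characterSpace ℂ C) :=
  isOpenEmbedding_charExt.isEmbedding.t2Space

instance [SeparableSpace C] : SeparableSpace (Unitization ℂ C) :=
  (Unitization.uniformEquivProd (𝕜 := ℂ) (A := C)).symm.surjective.denseRange.separableSpace
    (Unitization.uniformEquivProd (𝕜 := ℂ) (A := C)).symm.continuous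

instance [SeparableSpace C] : MetrizableSpace (characterSpace ℂ (Unitization ℂ C)) :=
  WeakDual.metrizable_of_isCompact ℂ _ _ (isCompact_iff_compactSpace.2 inferInstance)

instance [SeparableSpace C] : SecondCountableTopology (characterSpace ℂ C) := by
  let _ : MetricSpace (characterSpace ℂ (Unitization ℂ C)) := metrizableSpaceMetric _
  have : SecondCountableTopology (characterSpace ℂ (Unitization ℂ C)) := inferInstance
  exact isOpenEmbedding_charExt.isEmbedding.secondCountableTopology

theorem norm_le_of_forall_norm_char_le {a : C} {M : ℝ} (hM : 0 ≤ M)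
    (h : ∀ χ : characterSpace ℂ C, ‖χ a‖ ≤ M) : ‖a‖ ≤ M := by
  rw [← Unitization.norm_inr (𝕜 := ℂ) a,
    ← (gelfandTransform_isometry (Unitization ℂ C)).norm_map_of_map_zero (map_zero _),
    ContinuousMap.norm_le _ hM]
  intro κ
  change ‖κ (a : Unitization ℂ C)‖ ≤ M
  by_cases hκ : charRes κ = 0
  · rw [← charRes_apply, hκ]
    exact norm_zero.trans_le hM
  · obtain ⟨χ, rfl⟩ := mem_range_charExt hκ
    rw [charExt_inr]
    exact h χ

theorem eq_zero_of_forall_char_eq_zero {a : C} (h : ∀ χ : characterSpace ℂ C, χ a = 0) : a = 0 :=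
  norm_le_zero_iff.1 <| norm_le_of_forall_norm_char_le le_rfl fun χ => by rw [h, norm_zero]

theorem exists_forall_char_eq {h : characterSpace ℂ C → ℂ} (hc : Continuous h)
    (hs : HasCompactSupport h) : ∃ a : C, ∀ χ : characterSpace ℂ C, χ a = h χ := by
  let e := (isOpenEmbedding_charExt (C := C)).isEmbedding.toHomeomorph
  let F : characterSpace ℂ (Unitization ℂ C) → ℂ := Function.extend Subtype.val (h ∘ e.symm) 0
  have hF : Continuous F := (hs.comp_homeomorph e.symm).continuous_extend_zero
    isOpenEmbedding_charExt.isOpen_range (hc.comp e.symm.continuous)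
  have hF_char (χ : characterSpace ℂ C) : F (charExt χ) = h χ :=
    (Subtype.val_injective.extend_apply (h ∘ e.symm) 0 (e χ)).trans
      (congrArg h (e.symm_apply_apply χ))
  have hF_infty : F (charInfty C) = 0 :=
    Function.extend_apply' _ _ _ fun ⟨x, hx⟩ => charInfty_notMem (hx ▸ x.2)
  obtain ⟨z, hz⟩ := (gelfandTransform_bijective (Unitization ℂ C)).2 ⟨F, hF⟩
  have hz_apply (κ : characterSpace ℂ (Unitization ℂ C)) : κ z = F κ := DFunLike.congr_fun hz κ
  have hz_fst : z.fst = 0 := by rw [← charInfty_apply, hz_apply, hF_infty]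
  exact ⟨z.snd, fun χ => by
    rw [← hF_char, ← hz_apply, char_apply, hz_fst, zero_add, charExt_inr]⟩

theorem exists_forall_char_star_mul_self_eq {r : characterSpace ℂ C → ℝ} (hc : Continuous r)
    (hs : HasCompactSupport r) (hr : ∀ χ, 0 ≤ r χ) :
    ∃ b : C, ∀ χ : characterSpace ℂ C, χ (star b * b) = r χ := by
  obtain ⟨b, hb⟩ := exists_forall_char_eq (h := fun χ => ((√(r χ) : ℝ) : ℂ)) (by fun_prop)
    (hs.comp_left (g := fun t => ((√t : ℝ) : ℂ)) (by simp))
  refine ⟨b, fun χ => ?_⟩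
  rw [map_mul, char_star, hb, Complex.conj_ofReal, ← Complex.ofReal_mul, Real.mul_self_sqrt (hr χ)]

theorem mul_eq_zero_of_disjoint {a b : C} {U V : Set (characterSpace ℂ C)} (hUV : Disjoint U V)
    (ha : ∀ χ ∉ U, (χ : characterSpace ℂ C) a = 0) (hb : ∀ χ ∉ V, (χ : characterSpace ℂ C) b = 0) :
    a * b = 0 := by
  refine eq_zero_of_forall_char_eq_zero fun χ => ?_
  by_cases hχ : χ ∈ U
  · rw [map_mul, hb χ (hUV.notMem_of_mem_left hχ), mul_zero]
  · rw [map_mul, ha χ hχ, zero_mul]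

end Spectrum

section Approximation

variable {X : Type*} [TopologicalSpace X] [T2Space X] [MeasurableSpace X] [BorelSpace X]
  {ν : Measure X}

theorem exists_isCompact_setIntegral_sdiff_norm_le {E : Type*} [NormedAddCommGroup E]
    [IsFiniteMeasure ν] [ν.InnerRegularCompactLTTop] {f : X → E} (hf : Integrable f ν) {s : Set X}
    (hs : MeasurableSet s) {δ : ℝ} (hδ : 0 < δ) :
    ∃ L ⊆ s, IsCompact L ∧ ∫ x in s \ L, ‖f x‖ ∂ν ≤ δ := by
  obtain ⟨η, hη, hη_small⟩ := exists_pos_setLIntegral_lt_of_measure_lt hf.2.ne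
    (ENNReal.ofReal_pos.2 hδ).ne'
  obtain ⟨L, hLs, hL, hνL⟩ := hs.exists_isCompact_sdiff_lt (measure_ne_top ν s) hη.ne'
  refine ⟨L, hLs, hL, ?_⟩
  rw [integral_norm_eq_lintegral_enorm hf.1.restrict]
  exact ENNReal.toReal_le_of_le_ofReal hδ.le (hη_small _ hνL).le

theorem exists_continuous_integral_indicator_sub_le [LocallyCompactSpace X] [NormalSpace X]
    [ν.Regular] {G : X → ℝ} (hG : Integrable G ν) {m : ℝ} (hm : 0 ≤ m)
    (hGm : ∀ x, G x ∈ Set.Icc 0 m)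
    {L V : Set X} (hL : IsCompact L) (hV : IsOpen V) (hLV : L ⊆ V) {δ : ℝ} (hδ : 0 < δ) :
    ∃ r : X → ℝ, Continuous r ∧ HasCompactSupport r ∧ (∀ x, r x ∈ Set.Icc 0 m) ∧
      (∀ x ∉ V, r x = 0) ∧ ∫ x, ‖L.indicator G x - r x‖ ∂ν ≤ δ := by
  have hGL := hG.indicator hL.measurableSet
  obtain ⟨h, -, h_close, h_cont, h_int⟩ := hGL.exists_hasCompactSupport_integral_sub_le hδ
  obtain ⟨u, hu_one, hu_zero, hu_supp, hu⟩ := exists_continuous_one_zero_of_isCompact hL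
    hV.isClosed_compl (Set.disjoint_compl_right_iff_subset.2 hLV)
  let q (t : ℝ) : ℝ := Set.projIcc 0 m hm t
  have hq_of_mem {t : ℝ} (ht : t ∈ Set.Icc 0 m) : q t = t :=
    congrArg Subtype.val (Set.projIcc_of_mem hm ht)
  have h_pointwise (x : X) : ‖L.indicator G x - u x * q (h x)‖ ≤ ‖L.indicator G x - h x‖ := by
    have hGL_mem : L.indicator G x ∈ Set.Icc 0 m :=
      ⟨Set.indicator_nonneg (fun y _ => (hGm y).1) x,
        Set.indicator_le' (fun y _ => (hGm y).2) (fun _ _ => hm) x⟩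
    have hGL_eq : L.indicator G x = u x * q (L.indicator G x) := by
      rw [hq_of_mem hGL_mem]
      by_cases hx : x ∈ L
      · rw [hu_one hx, Pi.one_apply, one_mul]
      · rw [Set.indicator_of_notMem hx, mul_zero]
    calc ‖L.indicator G x - u x * q (h x)‖ = |u x| * |q (L.indicator G x) - q (h x)| := by
          rw [← abs_mul, mul_sub, ← hGL_eq, Real.norm_eq_abs]
      _ ≤ 1 * |L.indicator G x - h x| :=
          mul_le_mul (abs_le.2 ⟨by linarith [(hu x).1], (hu x).2⟩) (Set.abs_projIcc_sub_projIcc hm)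
            (abs_nonneg _) zero_le_one
      _ = ‖L.indicator G x - h x‖ := by rw [one_mul, Real.norm_eq_abs]
  refine ⟨fun x => u x * q (h x), ?_, hu_supp.mul_right, fun x => ?_, fun x hx => ?_, ?_⟩
  · exact u.continuous.mul (continuous_subtype_val.comp (continuous_projIcc.comp h_cont))
  · have hq : q (h x) ∈ Set.Icc 0 m := Subtype.property _
    exact ⟨mul_nonneg (hu x).1 hq.1, (mul_le_of_le_one_left hq.1 (hu x).2).trans hq.2⟩
  · simp only [hu_zero hx, Pi.zero_apply, zero_mul]
  · exact (integral_mono_of_nonneg (ae_of_all _ fun _ => norm_nonneg _) (hGL.sub h_int).norm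
      (ae_of_all _ h_pointwise)).trans h_close

end Approximation

namespace BoundedBorel

variable {X : Type*} [MeasurableSpace X]

/-- The product of a bounded Borel function with the indicator function of a measurable set, that
is, its truncation to that set. -/
def indicator (g : BoundedBorel X) {s : Set X} (hs : MeasurableSet s) : BoundedBorel X :=
  ⟨⟨s.indicator g, memℓp_infty ⟨‖g‖, by
    rintro _ ⟨x, rfl⟩
    exact (norm_indicator_le_norm_self _ _).trans (g.norm_apply_le x)⟩⟩, g.measurable.indicator hs⟩

theorem indicator_apply (g : BoundedBorel X) {s : Set X} (hs : MeasurableSet s) (x : X) :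
    g.indicator hs x = s.indicator g x := rfl

theorem sub_apply (f g : BoundedBorel X) (x : X) : (f - g) x = f x - g x := rfl

theorem measurableSet_support (g : BoundedBorel X) : MeasurableSet (Function.support g) :=
  (g.measurable (measurableSet_singleton 0)).compl

theorem indicator_support (g : BoundedBorel X) : g.indicator g.measurableSet_support = g :=
  Subtype.ext (lp.ext Set.indicator_support)

theorem indicator_sdiff (g : BoundedBorel X) {s L : Set X} (hs : MeasurableSet s)
    (hL : MeasurableSet L) (hLs : L ⊆ s) :
    g.indicator (hs.diff hL) = g.indicator hs - g.indicator hL :=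
  Subtype.ext (lp.ext (Set.indicator_sdiff hLs _))

theorem disjoint_support {f g : BoundedBorel X} (h : Orthogonal f g) :
    Disjoint (Function.support f) (Function.support g) :=
  Set.disjoint_left.2 fun x hf hg =>
    mul_ne_zero hf hg (congrArg (fun k : BoundedBorel X => k x) h.1)

theorem eq_re_of_nonneg {g : BoundedBorel X} (hg : 0 ≤ g) (x : X) : g x = ((g x).re : ℂ) :=
  Complex.ext rfl (Complex.le_def.1 (hg x)).2.symm

theorem re_mem_Icc_of_nonneg {g : BoundedBorel X} (hg : 0 ≤ g) (x : X) :
    (g x).re ∈ Set.Icc 0 ‖g‖ :=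
  ⟨(Complex.le_def.1 (hg x)).1, (Complex.re_le_norm _).trans (g.norm_apply_le x)⟩

end BoundedBorel

section BorelBidual

variable {C : Type*} [NonUnitalCommCStarAlgebra C]

/-- The Gelfand transform of `a` as a bounded Borel function on the spectrum. -/
def gelfandBorel (a : C) : BoundedBorel (characterSpace ℂ C) :=
  ⟨⟨fun χ => χ a, memℓp_infty ⟨‖a‖, by
    rintro _ ⟨χ, rfl⟩
    exact norm_char_apply_le χ a⟩⟩, (continuous_char_apply a).measurable⟩

theorem gelfandBorel_apply (a : C) (χ : characterSpace ℂ C) : gelfandBorel a χ = χ a := rfl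

variable [SeparableSpace C]

theorem borelBidual_gelfandBorel (a : C) (ψ : StrongDual ℂ C) :
    borelBidual C (gelfandBorel a) ψ = ψ a := by
  obtain ⟨μ, hμ, -⟩ := exists_represents ψ
  rw [borelBidual_apply _ ψ μ hμ, hμ a]
  rfl

theorem exists_norm_borelBidual_le_integral (ψ : StrongDual ℂ C) :
    ∃ ν : Measure (characterSpace ℂ C), IsFiniteMeasure ν ∧
      ∀ f : BoundedBorel (characterSpace ℂ C), ‖borelBidual C f ψ‖ ≤ ∫ χ, ‖f χ‖ ∂ν := by
  obtain ⟨μ, hμ, -⟩ := exists_represents ψ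
  refine ⟨∑ k, (μ k : Measure (characterSpace ℂ C)), inferInstance, fun f => ?_⟩
  rw [borelBidual_apply f ψ μ hμ, integral_finsetSum_measure fun k _ => (integrable_borel f _).norm]
  refine norm_sum_le_of_le _ fun k _ => ?_
  rw [norm_mul, norm_pow, Complex.norm_I, one_pow, one_mul]
  exact norm_integral_le_integral_norm _

theorem norm_borelBidual_indicator_le_of_isCompact {g : BoundedBorel (characterSpace ℂ C)}
    {s : Set (characterSpace ℂ C)} (hs : MeasurableSet s) {ψ : StrongDual ℂ C} {K : ℝ}
    (h : ∀ (L : Set (characterSpace ℂ C)) (hL : IsCompact L), L ⊆ s →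
      ‖borelBidual C (g.indicator hL.measurableSet) ψ‖ ≤ K) :
    ‖borelBidual C (g.indicator hs) ψ‖ ≤ K := by
  refine le_of_forall_pos_le_add fun δ hδ => ?_
  obtain ⟨ν, _, hν⟩ := exists_norm_borelBidual_le_integral ψ
  obtain ⟨L, hLs, hL, hL_small⟩ :=
    exists_isCompact_setIntegral_sdiff_norm_le (integrable_borel g ν) hs hδ
  have h_diff : ‖borelBidual C (g.indicator hs - g.indicator hL.measurableSet) ψ‖ ≤ δ := by
    rw [← g.indicator_sdiff hs hL.measurableSet hLs]
    refine (hν _).trans (le_of_eq_of_le ?_ hL_small)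
    simp only [BoundedBorel.indicator_apply, norm_indicator_eq_indicator_norm]
    exact integral_indicator (hs.diff hL.measurableSet)
  rw [map_sub, sub_apply] at h_diff
  linarith [norm_le_norm_add_norm_sub' (borelBidual C (g.indicator hs) ψ)
    (borelBidual C (g.indicator hL.measurableSet) ψ), h L hL hLs]

theorem norm_borelBidual_indicator_le_of_isOpen {g : BoundedBorel (characterSpace ℂ C)}
    (hg : 0 ≤ g) {L V : Set (characterSpace ℂ C)} (hL : IsCompact L) (hV : IsOpen V)
    (hLV : L ⊆ V) {ψ : StrongDual ℂ C} {K : ℝ}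
    (h : ∀ b : C, ‖star b * b‖ ≤ ‖g‖ → (∀ χ ∉ V, (χ : characterSpace ℂ C) (star b * b) = 0) →
      ‖ψ (star b * b)‖ ≤ K) :
    ‖borelBidual C (g.indicator hL.measurableSet) ψ‖ ≤ K := by
  refine le_of_forall_pos_le_add fun δ hδ => ?_
  obtain ⟨ν, _, hν⟩ := exists_norm_borelBidual_le_integral ψ
  obtain ⟨r, hr_cont, hr_supp, hr, hrV, hr_close⟩ := exists_continuous_integral_indicator_sub_le
    (integrable_borel g ν).re (norm_nonneg g) (BoundedBorel.re_mem_Icc_of_nonneg hg) hL hV hLV hδ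
  obtain ⟨b, hb⟩ := exists_forall_char_star_mul_self_eq hr_cont hr_supp fun χ => (hr χ).1
  have hb_norm : ‖star b * b‖ ≤ ‖g‖ := norm_le_of_forall_norm_char_le (norm_nonneg g) fun χ => by
    rw [hb, Complex.norm_real, Real.norm_of_nonneg (hr χ).1]
    exact (hr χ).2
  have h_diff :
      ‖borelBidual C (g.indicator hL.measurableSet - gelfandBorel (star b * b)) ψ‖ ≤ δ := by
    refine (hν _).trans (le_of_eq_of_le ?_ hr_close)
    congr 1 with χ
    rw [BoundedBorel.sub_apply, gelfandBorel_apply, hb, BoundedBorel.indicator_apply,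
      ← Complex.norm_real, Complex.ofReal_sub]
    by_cases hχ : χ ∈ L
    · simp only [Set.indicator_of_mem hχ, RCLike.re_to_complex, ← BoundedBorel.eq_re_of_nonneg hg]
    · simp only [Set.indicator_of_notMem hχ, Complex.ofReal_zero]
  rw [map_sub, sub_apply, borelBidual_gelfandBorel] at h_diff
  linarith [norm_le_norm_add_norm_sub' (borelBidual C (g.indicator hL.measurableSet) ψ)
    (ψ (star b * b)), h b hb_norm fun χ hχ => by rw [hb, hrV χ hχ, Complex.ofReal_zero]]

end BorelBidual

section UniformlyExhaustive

variable {C : Type*} [NonUnitalCommCStarAlgebra C] [SeparableSpace C]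
  {𝒦 : Set (StrongDual ℂ C)} {g : BoundedBorel (characterSpace ℂ C)}

theorem UniformlyExhaustive.exists_norm_borelBidual_indicator_le (h𝒦 : UniformlyExhaustive 𝒦)
    (hg : 0 ≤ g) {δ : ℝ} (hδ : 0 < δ) :
    ∃ n : ℕ, ∀ (β : Fin n → StrongDual ℂ C) (L : Fin n → Compacts (characterSpace ℂ C)),
      (∀ i, β i ∈ 𝒦) → Pairwise (Disjoint on fun i => (L i : Set (characterSpace ℂ C))) →
        ∃ i, ‖borelBidual C (g.indicator (L i).isCompact.measurableSet) (β i)‖ ≤ δ := by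
  obtain ⟨n, hn⟩ := h𝒦 ‖g‖ δ hδ
  refine ⟨n, fun β L hβ hL => ?_⟩
  by_contra! h_large
  have h_nhds : Pairwise (Disjoint on fun i => nhdsSet (L i : Set (characterSpace ℂ C))) :=
    fun i j hij => separatedNhds_iff_disjoint.1 <|
      .of_isCompact_isCompact (L i).isCompact (L j).isCompact (hL hij)
  obtain ⟨V, hLV, hV⟩ := h_nhds.exists_mem_filter_basis_of_disjoint fun i => hasBasis_nhdsSet _
  have h_lift (i : Fin n) : ∃ b : C, ‖star b * b‖ ≤ ‖g‖ ∧
      (∀ χ ∉ V i, (χ : characterSpace ℂ C) (star b * b) = 0) ∧ δ < ‖β i (star b * b)‖ := by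
    by_contra! h
    exact (h_large i).not_ge
      (norm_borelBidual_indicator_le_of_isOpen hg (L i).isCompact (hLV i).1 (hLV i).2 h)
  choose b hb hbV hbβ using h_lift
  obtain ⟨i, hi⟩ := hn β (fun i => star (b i) * b i) hβ (fun i => .star_mul_self _) hb
    fun i j hij => mul_eq_zero_of_disjoint (hV hij) (hbV i) (hbV j)
  exact (hbβ i).not_gt hi

/- Otherwise one could keep choosing functionals in `𝒦` together with pairwise disjoint compact
subsets of `s` on which they are large. -/
theorem UniformlyExhaustive.exists_isCompact_norm_borelBidual_sdiff_le
    (h𝒦 : UniformlyExhaustive 𝒦) (hg : 0 ≤ g) {s : Set (characterSpace ℂ C)}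
    (hs : MeasurableSet s) {δ : ℝ} (hδ : 0 < δ) :
    ∃ (L : Set (characterSpace ℂ C)) (hL : IsCompact L), L ⊆ s ∧
      ∀ β ∈ 𝒦, ‖borelBidual C (g.indicator (hs.diff hL.measurableSet)) β‖ ≤ δ := by
  by_contra! h_escape
  let Large (p : StrongDual ℂ C × Compacts (characterSpace ℂ C)) : Prop :=
    p.1 ∈ 𝒦 ∧ (p.2 : Set (characterSpace ℂ C)) ⊆ s ∧
      δ < ‖borelBidual C (g.indicator p.2.isCompact.measurableSet) p.1‖
  let Apart (p q : StrongDual ℂ C × Compacts (characterSpace ℂ C)) : Prop :=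
    Disjoint (p.2 : Set (characterSpace ℂ C)) q.2
  have : Std.Symm Apart := ⟨fun _ _ h => Disjoint.symm h⟩
  have h_extend (F : Finset (StrongDual ℂ C × Compacts (characterSpace ℂ C)))
      (hF : ∀ p ∈ F, Large p) : ∃ q, Large q ∧ ∀ p ∈ F, Apart p q := by
    let L : Set (characterSpace ℂ C) := ⋃ p ∈ F, (p.2 : Set (characterSpace ℂ C))
    obtain ⟨β, hβ, hβL⟩ := h_escape L (F.isCompact_biUnion fun p _ => p.2.isCompact)
      (Set.iUnion₂_subset fun p hp => (hF p hp).2.1)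
    obtain ⟨M, hM, hMs, hβM⟩ : ∃ (M : Set (characterSpace ℂ C)) (hM : IsCompact M), M ⊆ s \ L ∧
        δ < ‖borelBidual C (g.indicator hM.measurableSet) β‖ := by
      by_contra! h
      exact hβL.not_ge (norm_borelBidual_indicator_le_of_isCompact _ h)
    refine ⟨(β, ⟨M, hM⟩), ⟨hβ, hMs.trans Set.sdiff_subset, hβM⟩, fun p hp => ?_⟩
    exact Set.disjoint_left.2 fun χ hχp hχM => (hMs hχM).2 (Set.mem_biUnion hp hχp)
  obtain ⟨p, hp_large, hp_apart⟩ := exists_seq_of_forall_finset_exists' Large Apart h_extend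
  obtain ⟨n, hn⟩ := h𝒦.exists_norm_borelBidual_indicator_le hg hδ
  obtain ⟨i, hi⟩ := hn (fun i => (p i).1) (fun i => (p i).2) (fun i => (hp_large i).1)
    fun i j hij => hp_apart (Fin.val_injective.ne hij)
  exact (hp_large i).2.2.not_ge hi

end UniformlyExhaustive

section OrderZero

variable {B : Type*} [NonUnitalCStarAlgebra B] {ε : ℝ}

theorem IsEpsOrderZero.norm_apply_star_mul_self_mul_le {C : Type*} [NonUnitalCommCStarAlgebra C]
    [PartialOrder C] [StarOrderedRing C] {φ : C →L[ℂ] B} (hφ : IsEpsOrderZero ε φ)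
    {U V : Set (characterSpace ℂ C)} (hUV : Disjoint U V) {a c : C}
    (ha : ∀ χ ∉ U, (χ : characterSpace ℂ C) (star a * a) = 0)
    (hc : ∀ χ ∉ V, (χ : characterSpace ℂ C) (star c * c) = 0) :
    ‖φ (star a * a) * φ (star c * c)‖ ≤ ε * ‖star a * a‖ * ‖star c * c‖ := by
  have h_mul : star a * a * (star c * c) = 0 := mul_eq_zero_of_disjoint hUV ha hc
  refine hφ _ _ (star_mul_self_nonneg a) (star_mul_self_nonneg c)
    ⟨h_mul, mul_comm (star c * c) _ ▸ h_mul, ?_, ?_⟩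
  · rwa [(IsSelfAdjoint.star_mul_self a).star_eq]
  · rwa [(IsSelfAdjoint.star_mul_self c).star_eq]

theorem IsEpsOrderZero.bidual_comp_borelBidual {C : Type*} [NonUnitalCommCStarAlgebra C]
    [SeparableSpace C] [PartialOrder C] [StarOrderedRing C] {φ : C →L[ℂ] B} (hε : 0 ≤ ε)
    (hφ : IsEpsOrderZero ε φ) :
    IsEpsOrderZero (A := BoundedBorel (characterSpace ℂ C)) (E := Bidual B) ε
      (φ.bidual.comp (borelBidual C)) := by
  intro f g hf hg hfg
  refine ContinuousLinearMap.opNorm_le_bound _ (by positivity) fun ξ => ?_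
  let β (b : B) : StrongDual ℂ C := (ξ.comp (ContinuousLinearMap.mul ℂ B b)).comp φ
  let Ψ : StrongDual ℂ C := (arensAct (φ.bidual (borelBidual C g)) ξ).comp φ
  suffices h_ind : ‖borelBidual C (f.indicator f.measurableSet_support) Ψ‖ ≤
      ε * ‖f‖ * ‖g‖ * ‖ξ‖ by
    rwa [f.indicator_support] at h_ind
  refine norm_borelBidual_indicator_le_of_isCompact _ fun P hP hPf => ?_
  refine le_of_forall_pos_le_add fun δ hδ => ?_
  obtain ⟨L, hL, hLg, h_tail⟩ := (uniformlyExhaustive_image_closedBall φ ξ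
    (‖φ‖ * ‖f‖)).exists_isCompact_norm_borelBidual_sdiff_le hg g.measurableSet_support hδ
  obtain ⟨U, V, hU, hV, hPU, hLV, hUV⟩ := SeparatedNhds.of_isCompact_isCompact hP hL
    ((BoundedBorel.disjoint_support hfg).mono hPf hLg)
  refine norm_borelBidual_indicator_le_of_isOpen hf hP hU hPU fun a ha haU => ?_
  change ‖borelBidual C g (β (φ (star a * a)))‖ ≤ _
  have h_compact : ‖borelBidual C (g.indicator hL.measurableSet) (β (φ (star a * a)))‖ ≤
      ε * ‖f‖ * ‖g‖ * ‖ξ‖ := by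
    refine norm_borelBidual_indicator_le_of_isOpen hg hL hV hLV fun c hc hcV => ?_
    calc ‖ξ (φ (star a * a) * φ (star c * c))‖
        ≤ ‖ξ‖ * ‖φ (star a * a) * φ (star c * c)‖ := ξ.le_opNorm _
      _ ≤ ‖ξ‖ * (ε * ‖star a * a‖ * ‖star c * c‖) := by
        gcongr
        exact hφ.norm_apply_star_mul_self_mul_le hUV haU hcV
      _ ≤ ‖ξ‖ * (ε * ‖f‖ * ‖g‖) := by gcongr
      _ = ε * ‖f‖ * ‖g‖ * ‖ξ‖ := mul_comm _ _
  have h_rest := h_tail (β (φ (star a * a)))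
    ⟨_, mem_closedBall_zero_iff.2 (φ.le_opNorm_of_le ha), rfl⟩
  rw [g.indicator_sdiff g.measurableSet_support hL.measurableSet hLg, g.indicator_support, map_sub,
    sub_apply] at h_rest
  linarith [norm_le_norm_add_norm_sub' (borelBidual C g (β (φ (star a * a))))
    (borelBidual C (g.indicator hL.measurableSet) (β (φ (star a * a))))]

theorem IsEpsOrderZero.comp_nonUnitalStarAlgHom {A D : Type*} [NonUnitalCStarAlgebra A]
    [PartialOrder A] [StarOrderedRing A] [NonUnitalCStarAlgebra D] [PartialOrder D]
    [StarOrderedRing D] {φ : A →L[ℂ] B} (hε : 0 ≤ ε) (hφ : IsEpsOrderZero ε φ) (π : D →⋆ₙₐ[ℂ] A)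
    (hπ : Continuous π) : IsEpsOrderZero ε (φ.comp ⟨(π : D →ₗ[ℂ] A), hπ⟩) := by
  intro x y hx hy hxy
  have h_orthogonal : Orthogonal (π x) (π y) := by
    obtain ⟨h₁, h₂, h₃, h₄⟩ := hxy
    refine ⟨?_, ?_, ?_, ?_⟩ <;> simp only [← map_star, ← map_mul, h₁, h₂, h₃, h₄, map_zero]
  calc ‖φ (π x) * φ (π y)‖ ≤ ε * ‖π x‖ * ‖π y‖ :=
        hφ _ _ (map_nonneg π hx) (map_nonneg π hy) h_orthogonal
    _ ≤ ε * ‖x‖ * ‖y‖ := by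
        gcongr <;> exact NonUnitalStarAlgHom.norm_apply_le π _

end OrderZero

theorem proposition4p1 {A B : Type*} [NonUnitalCStarAlgebra A] [PartialOrder A] [StarOrderedRing A]
    [NonUnitalCStarAlgebra B] (ε : ℝ) (hε : 0 ≤ ε) (φ : A →L[ℂ] B) (hφ : IsEpsOrderZero ε φ)
    (A₀ : NonUnitalStarSubalgebra ℂ A) [IsClosed (A₀ : Set A)] [IsMulCommutative A₀]
    [TopologicalSpace.SeparableSpace A₀] :
    IsEpsOrderZero (A := BoundedBorel (WeakDual.characterSpace ℂ A₀)) (E := Bidual B) ε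
      (φ.bidual.comp (borelInclusion A₀)) := by
  let _ : PartialOrder A₀ := CStarAlgebra.spectralOrder A₀
  have _ : StarOrderedRing A₀ := CStarAlgebra.spectralOrderedRing A₀
  let ι : A₀ →L[ℂ] A := ⟨A₀.subtype, continuous_subtype_val⟩
  have hι : IsEpsOrderZero ε (φ.comp ι) :=
    hφ.comp_nonUnitalStarAlgHom hε (NonUnitalStarSubalgebraClass.subtype A₀) continuous_subtype_val
  have h_bidual : φ.bidual.comp (borelInclusion A₀) = (φ.comp ι).bidual.comp (borelBidual A₀) := rfl
  rw [h_bidual]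
  exact hι.bidual_comp_borelBidual hε

end
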